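/- Let $(D,\mu)$ be a probability space, let $B(D)$ be the space of bounded functions $f\colon D\to\mathbb{C}$ with $\|f\|_\infty=\sup_{x\in D}|f(x)|$, and let $B_\mu(D)\subset B(D)$ be the subspace of bounded measurable functions. Let $n\ge 1$ and let $V_n$ be an $n$-dimensional (complex) linear subspace of $B_\mu(D)$. Then there are points $x_1,\dots,x_{4n}\in D$ (not necessarily distinct), forming a multiset $X$, such that the following holds. The seminorm $\|g\|_X:=\big(\frac1{4n}\sum_{k=1}^{4n}|g(x_k)|^2\big)^{1/2}$ is a norm on $V_n$, and the unweighted least-squares algorithm $$A(X,V_n)f:=\operatorname*{argmin}_{g\in V_n}\|g-f\|_X$$ is well defined on $B(D)$, i.e. for every $f\in B(D)$ there is exactly one minimizer. Moreover, for all $f\in B_\mu(D)$ and all $1\le p\le\infty$, $$\|f-A(X,V_n)f\|_{L_p(\mu)}\le 84\,n^{(1/2-1/p)_+}\,\inf_{g\in V_n}\|f-g\|_\infty,$$ where $a_+:=\max\{a,0\}$ and $1/\infty:=0$. In particular, the points $X$ and the algorithm $A(X,V_n)$ depend neither on $f$ nor on $p$. -/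

import Mathlib

open MeasureTheory
open scoped ENNReal

/-- `B(D)`: the space of bounded complex-valued functions on the set `D`. -/
def boundedFunctions (D : Type*) : Submodule ℂ (D → ℂ) where
  carrier := {f | ∃ C : ℝ, ∀ x, ‖f x‖ ≤ C}
  zero_mem' := ⟨0, fun x => by simp⟩
  add_mem' := by
    rintro f g ⟨C, hC⟩ ⟨C', hC'⟩
    exact ⟨C + C', fun x => (norm_add_le _ _).trans (add_le_add (hC x) (hC' x))⟩
  smul_mem' := by
    rintro c f ⟨C, hC⟩
    refine ⟨‖c‖ * C, fun x => ?_⟩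
    rw [Pi.smul_apply, norm_smul]
    exact mul_le_mul_of_nonneg_left (hC x) (norm_nonneg c)

/-- The space of bounded measurable complex-valued functions on the measurable space `D`,
written `B_μ(D)` when `D` carries a measure `μ`. -/
def boundedMeasurableFunctions (D : Type*) [MeasurableSpace D] : Submodule ℂ (D → ℂ) where
  carrier := {f | f ∈ boundedFunctions D ∧ Measurable f}
  zero_mem' := ⟨Submodule.zero_mem _, measurable_zero⟩
  add_mem' := fun hf hg => ⟨Submodule.add_mem _ hf.1 hg.1, hf.2.add hg.2⟩
  smul_mem' := fun c _ hf => ⟨Submodule.smul_mem _ c hf.1, hf.2.const_smul c⟩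

/-- The sup-norm `‖f‖_∞ = sup_{x ∈ D} |f x|` of a bounded function on a nonempty set. -/
noncomputable def supNorm {D : Type*} (f : D → ℂ) : ℝ :=
  ⨆ x, ‖f x‖

/-- `inf_{g ∈ V} ‖f - g‖_∞`, the error of best uniform approximation of `f` from `V`. -/
noncomputable def bestUniformError {D : Type*} (V : Submodule ℂ (D → ℂ)) (f : D → ℂ) : ℝ :=
  ⨅ g : V, supNorm (f - (g : D → ℂ))

/-- The discrete seminorm `‖f‖_X = (|X|⁻¹ ∑_{x ∈ X} |f x|²)^{1/2}`, where the multiset `X` is given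
as the family of points `X 0, …, X (m - 1)`. -/
noncomputable def sampleNorm {D : Type*} {m : ℕ} (X : Fin m → D) (f : D → ℂ) : ℝ :=
  Real.sqrt ((1 / (m : ℝ)) * ∑ i, ‖f (X i)‖ ^ 2)

/-- `g` minimizes `‖g - f‖_X` over `g ∈ V`. -/
def IsLeastSquaresFit {D : Type*} {m : ℕ} (X : Fin m → D) (V : Submodule ℂ (D → ℂ))
    (f g : D → ℂ) : Prop :=
  g ∈ V ∧ ∀ h ∈ V, sampleNorm X (g - f) ≤ sampleNorm X (h - f)

open Classical in
/-- The unweighted least-squares algorithm `A(X, V) f = argmin_{g ∈ V} ‖g - f‖_X`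
(with value `0` if there is no minimizer; the minimizer is unique when `‖·‖_X` is a norm
on `V`). -/
noncomputable def leastSquares {D : Type*} {m : ℕ} (X : Fin m → D) (V : Submodule ℂ (D → ℂ))
    (f : D → ℂ) : D → ℂ :=
  if h : ∃ g, IsLeastSquaresFit X V f g then h.choose else 0

/-! Everything reduces to finding `4 n` points whose sample norm controls both `‖g‖_{L²(μ)}` and
`n^{-1/2} ‖g‖_∞` on `V`, up to a factor 4 (`exists_points_norm_le`). Given this, comparing the fit
`A` with any `g ∈ V` gives `‖g - A‖_X ≤ 2 ‖f - g‖_∞`, and interpolation between the two bounds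
covers all `p`.

The uniform norm is handled by a design: near-maximizing a Gram determinant over `2 n` points `Y`
gives `‖g‖_∞² ≤ ∑ |g(Y k)|²` (`exists_design`). Let `ρ` be the average of `μ` and the uniform
distribution on `Y`. Then the `L²(ρ)` norm dominates both target norms, so one `L²` discretization
suffices.

That discretization is the lower half of the Batson–Spielman–Srivastava argument
(`exists_barrier_step`). In `L²(ρ)`-orthonormal coordinates, each step lowers the matrix by `1/2`
and adds one rank-one term, keeping it positive definite with inverse trace at most 1. Only a lower
frame bound is needed, which is why no weights appear. -/

open scoped Matrix ComplexOrder

/-! ### Lower barrier argument -/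

/-- The scalar inequality behind a shift by `1 / 2` of the lower barrier. -/
lemma barrier_shift_le {ι : Type*} [Fintype ι] (d : ι → ℝ) (hd : ∀ i, 1 ≤ d i)
    (htr : ∑ i, (d i)⁻¹ ≤ 1) :
    (∑ i, (d i - 1 / 2)⁻¹ - ∑ i, (d i)⁻¹) * (1 + ∑ i, (d i - 1 / 2)⁻¹) ≤
      ∑ i, ((d i - 1 / 2)⁻¹) ^ 2 := by
  -- With `b = d - 1/2`: `1/b - 1/d = 1/(2bd)` and `1/b² = 1/(bd) + 1/(2b²d)`. For `Φ = ∑ 1/d ≤ 1`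
  -- the claim becomes `(S/2)(1 + Φ + S/2) ≤ S + Q/2`, and Cauchy–Schwarz gives `S² ≤ QΦ ≤ Q`.
  set S := ∑ i, (d i - 1 / 2)⁻¹ * (d i)⁻¹ with hS
  set Q := ∑ i, ((d i - 1 / 2)⁻¹) ^ 2 * (d i)⁻¹ with hQ
  have hb : ∀ i, 0 < d i - 1 / 2 := fun i => by linarith [hd i]
  have hd0 : ∀ i, 0 < d i := fun i => by linarith [hd i]
  have h1 : ∑ i, (d i - 1 / 2)⁻¹ - ∑ i, (d i)⁻¹ = S / 2 := by
    rw [hS, ← Finset.sum_sub_distrib, Finset.sum_div]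
    refine Finset.sum_congr rfl fun i _ => ?_
    linear_combination (-(d i - 1 / 2)⁻¹) * inv_mul_cancel₀ (hd0 i).ne' +
      (d i)⁻¹ * inv_mul_cancel₀ (hb i).ne'
  have h2 : ∑ i, ((d i - 1 / 2)⁻¹) ^ 2 = S + Q / 2 := by
    rw [hS, hQ, Finset.sum_div, ← Finset.sum_add_distrib]
    refine Finset.sum_congr rfl fun i _ => ?_
    have := (hb i).ne'
    have := (hd0 i).ne'
    field_simp
    ring
  have hS0 : 0 ≤ S := Finset.sum_nonneg fun i _ =>
    mul_nonneg (inv_nonneg.2 (hb i).le) (inv_nonneg.2 (hd0 i).le)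
  have hQ0 : 0 ≤ Q := Finset.sum_nonneg fun i _ =>
    mul_nonneg (sq_nonneg _) (inv_nonneg.2 (hd0 i).le)
  have hCS : S ^ 2 ≤ Q * ∑ i, (d i)⁻¹ := by
    refine Finset.sum_sq_le_sum_mul_sum_of_sq_le_mul _
      (fun i _ => mul_nonneg (sq_nonneg _) (inv_nonneg.2 (hd0 i).le))
      (fun i _ => inv_nonneg.2 (hd0 i).le) fun i _ => le_of_eq (by ring)
  have h3 : ∑ i, (d i - 1 / 2)⁻¹ = S / 2 + ∑ i, (d i)⁻¹ := by linarith
  rw [h1, h2, h3]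
  nlinarith

/-- The Sherman–Morrison formula for the trace of the inverse of a rank-one update of a positive
diagonal matrix. -/
lemma posDef_diagonal_add_vecMulVec {ι : Type*} [Fintype ι] [DecidableEq ι] (b : ι → ℝ)
    (hb : ∀ i, 0 < b i) (u : ι → ℂ) :
    (Matrix.diagonal (fun i => (b i : ℂ)) + Matrix.vecMulVec u (star u)).PosDef ∧
      (Matrix.diagonal (fun i => (b i : ℂ)) + Matrix.vecMulVec u (star u))⁻¹.trace =
        ((∑ i, (b i)⁻¹ - (∑ i, (b i)⁻¹ ^ 2 * ‖u i‖ ^ 2) / (1 + ∑ i, (b i)⁻¹ * ‖u i‖ ^ 2) : ℝ) :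
          ℂ) := by
  refine ⟨(Matrix.PosDef.diagonal fun i => by exact_mod_cast hb i).add_posSemidef
    (Matrix.posSemidef_vecMulVec_self_star u), ?_⟩
  set s : ℝ := ∑ i, (b i)⁻¹ * ‖u i‖ ^ 2 with hs
  have hs0 : 0 ≤ s := Finset.sum_nonneg fun i _ =>
    mul_nonneg (inv_nonneg.2 (hb i).le) (sq_nonneg _)
  have hs1 : (1 + s : ℂ) ≠ 0 := by exact_mod_cast (by linarith : (1 + s : ℝ) ≠ 0)
  set w : ι → ℂ := fun i => (b i : ℂ)⁻¹ * u i with hw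
  have hus : star u ⬝ᵥ w = s := by
    simp only [dotProduct, hs, hw, Pi.star_apply]
    push_cast
    refine Finset.sum_congr rfl fun i _ => ?_
    rw [← Complex.conj_mul']
    simp only [RCLike.star_def]
    ring
  have hinv : (Matrix.diagonal (fun i => (b i : ℂ)) + Matrix.vecMulVec u (star u))⁻¹ =
      Matrix.diagonal (fun i => (b i : ℂ)⁻¹) -
        (1 + s : ℂ)⁻¹ • Matrix.vecMulVec w (star w) := by
    refine Matrix.inv_eq_right_inv ?_
    have e1 : Matrix.diagonal (fun i => (b i : ℂ)) * Matrix.diagonal (fun i => (b i : ℂ)⁻¹) = 1 := by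
      rw [Matrix.diagonal_mul_diagonal, ← Matrix.diagonal_one]
      congr 1
      funext i
      exact mul_inv_cancel₀ (by exact_mod_cast (hb i).ne')
    have e2 : Matrix.diagonal (fun i => (b i : ℂ)) * Matrix.vecMulVec w (star w) =
        Matrix.vecMulVec u (star w) := by
      rw [Matrix.mul_vecMulVec]
      congr 1
      funext i
      rw [Matrix.mulVec_diagonal, hw]
      exact mul_inv_cancel_left₀ (by exact_mod_cast (hb i).ne') _
    have e3 : Matrix.vecMulVec u (star u) * Matrix.diagonal (fun i => (b i : ℂ)⁻¹) =
        Matrix.vecMulVec u (star w) := by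
      rw [Matrix.vecMulVec_mul]
      congr 1
      funext i
      rw [Matrix.vecMul_diagonal, hw]
      simp [mul_comm]
    have e4 : Matrix.vecMulVec u (star u) * Matrix.vecMulVec w (star w) =
        (s : ℂ) • Matrix.vecMulVec u (star w) := by
      rw [Matrix.vecMulVec_mul_vecMulVec, hus]
      ext i j
      simp [Matrix.vecMulVec_apply]
      ring
    rw [mul_sub, add_mul, add_mul, e1, e3, Matrix.mul_smul, Matrix.mul_smul, e2, e4, smul_smul,
      add_sub_add_comm, add_comm]
    have : (1 + s : ℂ)⁻¹ + (1 + s : ℂ)⁻¹ * s = 1 := by field_simp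
    ext i j
    simp only [Matrix.add_apply, Matrix.sub_apply, Matrix.smul_apply, smul_eq_mul]
    linear_combination (-Matrix.vecMulVec u (star w) i j) * this
  rw [hinv, Matrix.trace_sub, Matrix.trace_smul, Matrix.trace_diagonal, Matrix.trace_vecMulVec]
  have : w ⬝ᵥ star w = ((∑ i, (b i)⁻¹ ^ 2 * ‖u i‖ ^ 2 : ℝ) : ℂ) := by
    simp only [dotProduct, hw, Pi.star_apply]
    push_cast
    refine Finset.sum_congr rfl fun i _ => ?_
    rw [← Complex.conj_mul']
    simp
    ring
  rw [this]
  push_cast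
  simp only [smul_eq_mul]
  ring

/-- One step of the lower barrier argument of Batson, Spielman and Srivastava, without weights. -/
lemma exists_barrier_step {D ι : Type*} [Fintype ι] [DecidableEq ι] [MeasurableSpace D]
    (ρ : Measure D) [IsProbabilityMeasure ρ] (v : D → ι → ℂ)
    (hint : ∀ c : ι → ℂ, Integrable (fun x => ‖c ⬝ᵥ v x‖ ^ 2) ρ)
    (hiso : ∀ c : ι → ℂ, ∫ x, ‖c ⬝ᵥ v x‖ ^ 2 ∂ρ = ∑ i, ‖c i‖ ^ 2)
    (M : Matrix ι ι ℂ) (hM : M.PosDef) (htr : (M⁻¹.trace).re ≤ 1) :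
    ∃ x, (M - (1 / 2 : ℂ) • 1 + Matrix.vecMulVec (v x) (star (v x))).PosDef ∧
      ((M - (1 / 2 : ℂ) • 1 + Matrix.vecMulVec (v x) (star (v x)))⁻¹.trace).re ≤ 1 := by
  set d := hM.1.eigenvalues with hd
  have hdpos : ∀ i, 0 < d i := hM.eigenvalues_pos
  set U : Matrix ι ι ℂ := (hM.1.eigenvectorUnitary : Matrix ι ι ℂ) with hU
  have hUU : U * Uᴴ = 1 := Unitary.coe_mul_star_self hM.1.eigenvectorUnitary
  have hUU' : Uᴴ * U = 1 := Unitary.coe_star_mul_self hM.1.eigenvectorUnitary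
  have hspec : M = U * Matrix.diagonal (fun i => (d i : ℂ)) * Uᴴ := by
    have := hM.1.spectral_theorem
    rw [Unitary.conjStarAlgAut_apply] at this
    exact this
  have hconj : ∀ A : Matrix ι ι ℂ, IsUnit A.det → (U * A * Uᴴ)⁻¹.trace = A⁻¹.trace := by
    intro A hA
    have : (U * A * Uᴴ)⁻¹ = U * A⁻¹ * Uᴴ := by
      refine Matrix.inv_eq_right_inv ?_
      calc U * A * Uᴴ * (U * A⁻¹ * Uᴴ) = U * A * (Uᴴ * U) * A⁻¹ * Uᴴ := by noncomm_ring
        _ = U * (A * A⁻¹) * Uᴴ := by rw [hUU']; noncomm_ring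
        _ = 1 := by rw [Matrix.mul_nonsing_inv _ hA, mul_one, hUU]
    rw [this, Matrix.trace_mul_cycle, hUU', one_mul]
  have hsum : ∑ i, (d i)⁻¹ ≤ 1 := by
    have hdet : IsUnit (Matrix.diagonal (fun i => (d i : ℂ))).det := by
      rw [Matrix.det_diagonal, isUnit_iff_ne_zero, Finset.prod_ne_zero_iff]
      exact fun i _ => by exact_mod_cast (hdpos i).ne'
    -- The update by the zero vector just reads off the inverse trace of a diagonal matrix.
    have h := posDef_diagonal_add_vecMulVec d hdpos 0
    have h2 : (M⁻¹.trace) = ((∑ i, (d i)⁻¹ : ℝ) : ℂ) := by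
      rw [hspec, hconj _ hdet]
      simpa using h.2
    rwa [h2, Complex.ofReal_re] at htr
  -- Each `1/d i` is one term of a sum at most 1, so the shift by `1/2` cannot destroy positivity.
  have hd1 : ∀ i, 1 ≤ d i := fun i => by
    have : (d i)⁻¹ ≤ 1 := (Finset.single_le_sum (f := fun i => (d i)⁻¹)
      (fun j _ => inv_nonneg.2 (hdpos j).le) (Finset.mem_univ i)).trans hsum
    exact (inv_le_one₀ (hdpos i)).1 this
  have hb : ∀ i, 0 < d i - 1 / 2 := fun i => by linarith [hd1 i]
  set Δ := ∑ i, (d i - 1 / 2)⁻¹ - ∑ i, (d i)⁻¹ with hΔ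
  set u : D → ι → ℂ := fun x => Uᴴ *ᵥ v x with hu
  have hui : ∀ x i, u x i = Uᴴ i ⬝ᵥ v x := fun x i => rfl
  have hcol : ∀ i, ∑ j, ‖Uᴴ i j‖ ^ 2 = 1 := fun i => by
    have := congrFun (congrFun hUU' i) i
    rw [Matrix.mul_apply, Matrix.one_apply_eq] at this
    have h2 : ((∑ j, ‖Uᴴ i j‖ ^ 2 : ℝ) : ℂ) = 1 := by
      rw [← this]
      push_cast
      refine Finset.sum_congr rfl fun j _ => ?_
      rw [← Complex.mul_conj', Matrix.conjTranspose_apply]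
      simp
    exact_mod_cast h2
  have hFint : ∀ i, Integrable (fun x => ‖u x i‖ ^ 2) ρ := fun i => hint (Uᴴ i)
  have hF1 : ∀ i, ∫ x, ‖u x i‖ ^ 2 ∂ρ = 1 := fun i => (hiso (Uᴴ i)).trans (hcol i)
  have hsumint : ∀ a : ι → ℝ, Integrable (fun x => ∑ i, a i * ‖u x i‖ ^ 2) ρ := fun a =>
    integrable_finsetSum _ fun i _ => (hFint i).const_mul _
  have hsumeq : ∀ a : ι → ℝ, ∫ x, ∑ i, a i * ‖u x i‖ ^ 2 ∂ρ = ∑ i, a i := fun a => by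
    rw [integral_finsetSum _ fun i _ => (hFint i).const_mul _]
    refine Finset.sum_congr rfl fun i _ => ?_
    rw [integral_const_mul, hF1, mul_one]
  -- By isotropy `|u x i|²` has mean 1, so the two quadratic forms average to `∑ b⁻²` and `∑ b⁻¹`.
  -- Some `x` does at least as well as the average; there the Sherman–Morrison decrease compensates
  -- the increase `Δ` caused by the shift.
  obtain ⟨x, hx⟩ := exists_integral_le (μ := ρ)
    ((hsumint fun i => (d i - 1 / 2)⁻¹ ^ 2).sub
      ((hsumint fun i => (d i - 1 / 2)⁻¹).const_mul Δ))
  simp only [Pi.sub_apply] at hx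
  rw [integral_sub (hsumint _) ((hsumint _).const_mul Δ), integral_const_mul, hsumeq, hsumeq] at hx
  refine ⟨x, ?_⟩
  have hkey : Δ * (1 + ∑ i, (d i - 1 / 2)⁻¹ * ‖u x i‖ ^ 2) ≤
      ∑ i, (d i - 1 / 2)⁻¹ ^ 2 * ‖u x i‖ ^ 2 := by
    have := barrier_shift_le d hd1 hsum
    rw [← hΔ] at this
    linarith
  have hrew : M - (1 / 2 : ℂ) • 1 + Matrix.vecMulVec (v x) (star (v x)) =
      U * (Matrix.diagonal (fun i => ((d i - 1 / 2 : ℝ) : ℂ)) +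
        Matrix.vecMulVec (u x) (star (u x))) * Uᴴ := by
    have e1 : Matrix.diagonal (fun i => ((d i - 1 / 2 : ℝ) : ℂ)) =
        Matrix.diagonal (fun i => (d i : ℂ)) - (1 / 2 : ℂ) • 1 := by
      rw [Matrix.smul_one_eq_diagonal, Matrix.diagonal_sub]
      congr 1
      funext i
      push_cast
      rfl
    have e2 : U * Matrix.vecMulVec (u x) (star (u x)) * Uᴴ =
        Matrix.vecMulVec (v x) (star (v x)) := by
      rw [Matrix.mul_vecMulVec, Matrix.vecMulVec_mul, ← Matrix.star_mulVec, hu]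
      simp only [Matrix.mulVec_mulVec, hUU, Matrix.one_mulVec]
    rw [e1, mul_add, add_mul, e2, mul_sub, sub_mul, ← hspec, Matrix.mul_smul, Matrix.smul_mul,
      mul_one, hUU]
  obtain ⟨hpd, htrace⟩ := posDef_diagonal_add_vecMulVec (fun i => d i - 1 / 2) hb (u x)
  have hUunit : IsUnit U := IsUnit.of_mul_eq_one _ hUU
  rw [hrew]
  refine ⟨(Matrix.IsUnit.posDef_star_right_conjugate_iff hUunit).2 hpd, ?_⟩
  rw [hconj _ (isUnit_iff_ne_zero.2 hpd.det_pos.ne'), htrace, Complex.ofReal_re]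
  have hs0 : 0 ≤ ∑ i, (d i - 1 / 2)⁻¹ * ‖u x i‖ ^ 2 := Finset.sum_nonneg fun i _ =>
    mul_nonneg (inv_nonneg.2 (hb i).le) (sq_nonneg _)
  have := (le_div_iff₀ (by linarith)).2 hkey
  linarith

/-- Iterating the barrier step. -/
lemma exists_points_posDef {D ι : Type*} [Fintype ι] [DecidableEq ι] [MeasurableSpace D]
    (ρ : Measure D) [IsProbabilityMeasure ρ] (v : D → ι → ℂ)
    (hint : ∀ c : ι → ℂ, Integrable (fun x => ‖c ⬝ᵥ v x‖ ^ 2) ρ)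
    (hiso : ∀ c : ι → ℂ, ∫ x, ‖c ⬝ᵥ v x‖ ^ 2 ∂ρ = ∑ i, ‖c i‖ ^ 2)
    (M : Matrix ι ι ℂ) (hM : M.PosDef) (htr : (M⁻¹.trace).re ≤ 1) (m : ℕ) :
    ∃ X : Fin m → D,
      (M - (m / 2 : ℂ) • 1 + ∑ k, Matrix.vecMulVec (v (X k)) (star (v (X k)))).PosDef := by
  induction m generalizing M with
  | zero => exact ⟨Fin.elim0, by simpa using hM⟩
  | succ m ih =>
    obtain ⟨x, hx, hxtr⟩ := exists_barrier_step ρ v hint hiso M hM htr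
    obtain ⟨X, hX⟩ := ih _ hx hxtr
    refine ⟨Fin.cons x X, ?_⟩
    convert hX using 1
    rw [Fin.sum_univ_succ]
    simp only [Fin.cons_zero, Fin.cons_succ]
    push_cast
    module

/-- Unweighted subsampling of an isotropic frame: `4 n` points suffice for the lower bound. -/
lemma exists_points_frame_le {D ι : Type*} [Fintype ι] [DecidableEq ι] [MeasurableSpace D]
    (ρ : Measure D) [IsProbabilityMeasure ρ] (v : D → ι → ℂ)
    (hint : ∀ c : ι → ℂ, Integrable (fun x => ‖c ⬝ᵥ v x‖ ^ 2) ρ)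
    (hiso : ∀ c : ι → ℂ, ∫ x, ‖c ⬝ᵥ v x‖ ^ 2 ∂ρ = ∑ i, ‖c i‖ ^ 2) :
    ∃ X : Fin (4 * Fintype.card ι) → D, ∀ c : ι → ℂ,
      Fintype.card ι * ∑ i, ‖c i‖ ^ 2 ≤ ∑ k, ‖c ⬝ᵥ v (X k)‖ ^ 2 := by
  cases isEmpty_or_nonempty ι
  · exact ⟨fun k => (Fin.cast (by simp) k : Fin 0).elim0, fun c => by
      simp⟩
  set n := Fintype.card ι with hn
  have hn0 : (0 : ℝ) < n := by exact_mod_cast Fintype.card_pos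
  have hMeq : (n : ℂ) • (1 : Matrix ι ι ℂ) = Matrix.diagonal (fun _ => ((n : ℝ) : ℂ)) := by
    rw [Matrix.smul_one_eq_diagonal]
    simp
  have h0 := posDef_diagonal_add_vecMulVec (fun _ : ι => (n : ℝ)) (fun _ => hn0) 0
  simp only [star_zero, Matrix.vecMulVec_zero, add_zero, ← hMeq] at h0
  -- The start `n • 1` has inverse trace exactly 1. After `4 n` steps the shift totals `2 n`,
  -- leaving `-n • 1` plus the frame operator.
  obtain ⟨X, hX⟩ := exists_points_posDef ρ v hint hiso ((n : ℂ) • 1) h0.1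
    (by rw [h0.2, Complex.ofReal_re]; simp [← hn, hn0.ne']) (4 * n)
  refine ⟨X, fun c => ?_⟩
  have := hX.posSemidef.dotProduct_mulVec_nonneg (star c)
  have heq : star (star c) ⬝ᵥ (((n : ℂ) • 1 - (((4 * n : ℕ) : ℂ) / 2) • 1 +
      ∑ k, Matrix.vecMulVec (v (X k)) (star (v (X k)))) *ᵥ star c) =
      ((∑ k, ‖c ⬝ᵥ v (X k)‖ ^ 2 - n * ∑ i, ‖c i‖ ^ 2 : ℝ) : ℂ) := by
    rw [Matrix.add_mulVec, Matrix.sub_mulVec, Matrix.smul_mulVec, Matrix.smul_mulVec,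
      Matrix.one_mulVec, Matrix.sum_mulVec, dotProduct_add, dotProduct_sub, dotProduct_smul,
      dotProduct_smul, star_star, dotProduct_sum]
    have e1 : c ⬝ᵥ star c = ((∑ i, ‖c i‖ ^ 2 : ℝ) : ℂ) := by
      simp only [dotProduct, Pi.star_apply]
      push_cast
      exact Finset.sum_congr rfl fun i _ => Complex.mul_conj' _
    have e2 : ∀ k, c ⬝ᵥ (Matrix.vecMulVec (v (X k)) (star (v (X k))) *ᵥ star c) =
        ((‖c ⬝ᵥ v (X k)‖ ^ 2 : ℝ) : ℂ) := fun k => by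
      rw [Matrix.vecMulVec_mulVec, dotProduct_smul, Matrix.star_dotProduct_star, dotProduct_comm c]
      push_cast
      rw [← Complex.mul_conj']
      rfl
    simp only [e1, e2, smul_eq_mul]
    push_cast
    ring
  rw [heq] at this
  have : (0 : ℝ) ≤ ∑ k, ‖c ⬝ᵥ v (X k)‖ ^ 2 - n * ∑ i, ‖c i‖ ^ 2 := by exact_mod_cast this
  linarith

/-! ### Frame operators and determinant-optimal designs -/

/-- The frame operator `∑ k, v k (v k)ᴴ` of a finite family of vectors. -/
noncomputable def frameMatrix {ι κ : Type*} [Fintype κ] (v : κ → ι → ℂ) : Matrix ι ι ℂ :=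
  ∑ k, Matrix.vecMulVec (v k) (star (v k))

section FrameMatrix

variable {ι κ : Type*} [Fintype κ]

lemma frameMatrix_posSemidef [Fintype ι] (v : κ → ι → ℂ) : (frameMatrix v).PosSemidef :=
  Matrix.posSemidef_sum _ fun k _ => Matrix.posSemidef_vecMulVec_self_star (v k)

lemma frameMatrix_mulVec [Fintype ι] (v : κ → ι → ℂ) (c : ι → ℂ) :
    frameMatrix v *ᵥ c = ∑ k, (star (v k) ⬝ᵥ c) • v k := by
  rw [frameMatrix, Matrix.sum_mulVec]
  refine Finset.sum_congr rfl fun k _ => ?_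
  rw [Matrix.vecMulVec_mulVec]
  ext i
  simp [mul_comm]

lemma frameMatrix_update [DecidableEq κ] (v : κ → ι → ℂ) (k : κ) (w : ι → ℂ) :
    frameMatrix (Function.update v k w) = frameMatrix v - Matrix.vecMulVec (v k) (star (v k)) +
      Matrix.vecMulVec w (star w) := by
  have h : (fun j => Matrix.vecMulVec (Function.update v k w j)
      (star (Function.update v k w j))) =
      Function.update (fun j => Matrix.vecMulVec (v j) (star (v j))) k
        (Matrix.vecMulVec w (star w)) := by
    funext j
    by_cases hj : j = k
    · subst hj; simp
    · simp [hj]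
  rw [frameMatrix, h, Finset.sum_update_of_mem (Finset.mem_univ k), frameMatrix,
    ← Finset.add_sum_erase _ _ (Finset.mem_univ k), Finset.sdiff_singleton_eq_erase]
  abel

/-- The determinant after exchanging one rank-one term for another one. -/
lemma det_sub_vecMulVec_add_vecMulVec {ι : Type*} [Fintype ι] [DecidableEq ι] (M : Matrix ι ι ℂ) (hM : IsUnit M.det) (u w : ι → ℂ) :
    (M - Matrix.vecMulVec u (star u) + Matrix.vecMulVec w (star w)).det =
      M.det * ((1 - star u ⬝ᵥ M⁻¹ *ᵥ u) * (1 + star w ⬝ᵥ M⁻¹ *ᵥ w) +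
        (star u ⬝ᵥ M⁻¹ *ᵥ w) * (star w ⬝ᵥ M⁻¹ *ᵥ u)) := by
  -- The exchange is a single rank-two update `P * Q`, so the matrix determinant lemma leaves a `2 ×
  -- 2` determinant.
  set P : Matrix ι (Fin 2) ℂ := (Matrix.of ![u, w])ᵀ with hP
  set Q : Matrix (Fin 2) ι ℂ := Matrix.of ![-star u, star w] with hQ
  have h : M - Matrix.vecMulVec u (star u) + Matrix.vecMulVec w (star w) = M + P * Q := by
    ext i j
    simp [hP, hQ, Matrix.mul_apply, Fin.sum_univ_two, Matrix.vecMulVec_apply]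
    ring
  have hQP : ∀ a b, (Q * M⁻¹ * P) a b = ![-star u, star w] a ⬝ᵥ M⁻¹ *ᵥ ![u, w] b := by
    intro a b
    rw [Matrix.mul_assoc]
    rfl
  rw [h, Matrix.det_add_mul _ _ hM, Matrix.det_fin_two]
  simp only [Matrix.add_apply, hQP, Matrix.one_apply_eq, ne_eq, zero_ne_one, not_false_eq_true,
    one_ne_zero, Matrix.one_apply_ne, Matrix.cons_val_zero, Matrix.cons_val_one,
    neg_dotProduct]
  ring

/-- Each term is the trace of `A⁻¹` times one rank-one summand of the frame operator `A`; together
they give the trace of the identity. -/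
lemma sum_star_dotProduct_inv_mulVec [Fintype ι] [DecidableEq ι] (v : κ → ι → ℂ) (h : IsUnit (frameMatrix v).det) :
    ∑ k, star (v k) ⬝ᵥ (frameMatrix v)⁻¹ *ᵥ v k = Fintype.card ι := by
  calc ∑ k, star (v k) ⬝ᵥ (frameMatrix v)⁻¹ *ᵥ v k
      = ∑ k, ((frameMatrix v)⁻¹ * Matrix.vecMulVec (v k) (star (v k))).trace := by
        refine Finset.sum_congr rfl fun k _ => ?_
        rw [Matrix.mul_vecMulVec, Matrix.trace_vecMulVec, dotProduct_comm]
    _ = ((frameMatrix v)⁻¹ * frameMatrix v).trace := by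
        rw [← Matrix.trace_sum, ← Finset.mul_sum, frameMatrix]
    _ = Fintype.card ι := by rw [Matrix.nonsing_inv_mul _ h, Matrix.trace_one]

lemma sum_star_dotProduct_inv_smul [Fintype ι] [DecidableEq ι] (v : κ → ι → ℂ) (h : IsUnit (frameMatrix v).det)
    (w : ι → ℂ) : ∑ k, (star (v k) ⬝ᵥ (frameMatrix v)⁻¹ *ᵥ w) • v k = w := by
  rw [← frameMatrix_mulVec, Matrix.mulVec_mulVec, Matrix.mul_nonsing_inv _ h, Matrix.one_mulVec]

lemma star_dotProduct_inv_mulVec_comm [Fintype ι] [DecidableEq ι] (v : κ → ι → ℂ) (u w : ι → ℂ) :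
    star w ⬝ᵥ (frameMatrix v)⁻¹ *ᵥ u = star (star u ⬝ᵥ (frameMatrix v)⁻¹ *ᵥ w) := by
  have h : ((frameMatrix v)⁻¹)ᴴ = (frameMatrix v)⁻¹ := (frameMatrix_posSemidef v).1.inv
  rw [Matrix.star_dotProduct, Matrix.star_mulVec, h, ← Matrix.dotProduct_mulVec]

/-- Expand the second `w` in the frame and pair with the first. This makes the squared `ℓ²` norm of
the canonical coefficients the same quantity that occurs in the exchange determinant. -/
lemma sum_norm_sq_star_dotProduct_inv [Fintype ι] [DecidableEq ι] (v : κ → ι → ℂ) (h : IsUnit (frameMatrix v).det)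
    (w : ι → ℂ) : ((∑ k, ‖star (v k) ⬝ᵥ (frameMatrix v)⁻¹ *ᵥ w‖ ^ 2 : ℝ) : ℂ) =
      star w ⬝ᵥ (frameMatrix v)⁻¹ *ᵥ w := by
  have hw : star w ⬝ᵥ (frameMatrix v)⁻¹ *ᵥ w = star w ⬝ᵥ (frameMatrix v)⁻¹ *ᵥ
      ∑ k, (star (v k) ⬝ᵥ (frameMatrix v)⁻¹ *ᵥ w) • v k := by
    rw [sum_star_dotProduct_inv_smul v h w]
  rw [hw, Matrix.mulVec_sum, dotProduct_sum]
  push_cast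
  refine Finset.sum_congr rfl fun k _ => ?_
  rw [Matrix.mulVec_smul, dotProduct_smul, star_dotProduct_inv_mulVec_comm, smul_eq_mul,
    ← Complex.mul_conj', starRingEnd_apply, star_star]

end FrameMatrix

/-- If the values of `v` separate, some family of `card ι` values has invertible frame operator. -/
lemma exists_isUnit_det_frameMatrix {D ι : Type*} [Fintype ι] [DecidableEq ι] (v : D → ι → ℂ)
    (hsep : ∀ c : ι → ℂ, (∀ x, c ⬝ᵥ v x = 0) → c = 0) :
    ∃ Y : ι ⊕ ι → D, (frameMatrix (v ∘ Y)).det ≠ 0 := by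
  have hspan : Submodule.span ℂ (Set.range v) = ⊤ := by
    by_contra hne
    obtain ⟨φ, hφ, hle⟩ := Submodule.exists_le_ker_of_lt_top _ (lt_top_iff_ne_top.2 hne)
    have hφc : ∀ w : ι → ℂ, φ w = (fun i => φ (Pi.single i 1)) ⬝ᵥ w := fun w => by
      rw [LinearMap.pi_apply_eq_sum_univ φ w]
      refine Finset.sum_congr rfl fun i _ => ?_
      rw [smul_eq_mul, mul_comm]
      congr 2
      funext j
      simp [Pi.single_apply, eq_comm]
    have hc := hsep (fun i => φ (Pi.single i 1)) fun x => by
      rw [← hφc]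
      exact hle (Submodule.subset_span ⟨x, rfl⟩)
    refine hφ (LinearMap.ext fun w => ?_)
    rw [hφc, hc, zero_dotProduct, LinearMap.zero_apply]
  obtain ⟨f, hf, hfspan, -⟩ := Submodule.exists_fun_fin_finrank_span_eq ℂ (Set.range v)
  choose y hy using hf
  have hcard : Fintype.card ι = Module.finrank ℂ (Submodule.span ℂ (Set.range v)) := by
    rw [hspan, finrank_top, Module.finrank_fintype_fun_eq_card]
  let e : ι ≃ Fin (Module.finrank ℂ (Submodule.span ℂ (Set.range v))) :=
    Fintype.equivFinOfCardEq hcard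
  -- Each point of a basis is listed twice, only to fill the `2 n` slots.
  refine ⟨fun k => y (e (k.elim id id)), fun hdet => ?_⟩
  obtain ⟨c, hc0, hc⟩ := Matrix.exists_mulVec_eq_zero_iff.2 hdet
  have h2 : star c ⬝ᵥ (frameMatrix (v ∘ fun k : ι ⊕ ι => y (e (k.elim id id))) *ᵥ c) = 0 := by
    rw [hc, dotProduct_zero]
  rw [frameMatrix_mulVec, dotProduct_sum] at h2
  have h3 : ∑ k : ι ⊕ ι, ‖star c ⬝ᵥ v (y (e (k.elim id id)))‖ ^ 2 = 0 := by
    have : ((∑ k : ι ⊕ ι, ‖star c ⬝ᵥ v (y (e (k.elim id id)))‖ ^ 2 : ℝ) : ℂ) = 0 := by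
      rw [← h2]
      push_cast
      refine Finset.sum_congr rfl fun k _ => ?_
      rw [dotProduct_smul, smul_eq_mul, ← Complex.conj_mul', Function.comp_apply,
        Matrix.star_dotProduct (v _)]
      rfl
    exact_mod_cast this
  have h4 : ∀ k, star c ⬝ᵥ f k = 0 := fun k => by
    have := (Finset.sum_eq_zero_iff_of_nonneg fun _ _ => sq_nonneg _).1 h3 (Sum.inl (e.symm k))
      (Finset.mem_univ _)
    simpa [hy] using this
  have h5 : ∀ w : ι → ℂ, star c ⬝ᵥ w = 0 := fun w => by
    have hw : w ∈ Submodule.span ℂ (Set.range f) := by rw [hfspan, hspan]; trivial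
    induction hw using Submodule.span_induction with
    | mem w hw => obtain ⟨k, rfl⟩ := hw; exact h4 k
    | zero => simp
    | add a b _ _ ha hb => rw [dotProduct_add, ha, hb, add_zero]
    | smul a b _ hb => rw [dotProduct_smul, hb, smul_zero]
  exact hc0 (dotProduct_star_self_eq_zero.1 (h5 c))

/-- A discrete form of the Kiefer–Wolfowitz theorem: nearly maximizing the determinant of the frame
operator over families of `2 n` points gives a stable representation of all other values. -/
lemma exists_design {D ι : Type*} [Fintype ι] [DecidableEq ι] [Nonempty ι] (v : D → ι → ℂ)
    (C : ℝ) (hC : ∀ x i, ‖v x i‖ ≤ C)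
    (hsep : ∀ c : ι → ℂ, (∀ x, c ⬝ᵥ v x = 0) → c = 0) :
    ∃ Y : ι ⊕ ι → D, ∀ x, ∃ a : ι ⊕ ι → ℂ, v x = ∑ k, a k • v (Y k) ∧ ∑ k, ‖a k‖ ^ 2 ≤ 1 := by
  set F : (ι ⊕ ι → D) → ℝ := fun Y => (frameMatrix (v ∘ Y)).det.re with hF
  have hFdet : ∀ Y, (frameMatrix (v ∘ Y)).det = (F Y : ℂ) := fun Y =>
    Complex.ext rfl (Complex.nonneg_iff.1 (frameMatrix_posSemidef (v ∘ Y)).det_nonneg).2.symm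
  have hF0 : ∀ Y, 0 ≤ F Y := fun Y =>
    (Complex.nonneg_iff.1 (frameMatrix_posSemidef (v ∘ Y)).det_nonneg).1
  have hbdd : BddAbove (Set.range F) := by
    refine ⟨(Fintype.card ι).factorial • (Fintype.card (ι ⊕ ι) * (C * C)) ^ Fintype.card ι, ?_⟩
    rintro _ ⟨Y, rfl⟩
    refine (Complex.re_le_norm _).trans (Matrix.det_le (abv := NormedField.toAbsoluteValue ℂ)
      fun i j => ?_)
    change ‖frameMatrix (v ∘ Y) i j‖ ≤ _
    rw [frameMatrix, Matrix.sum_apply]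
    refine (norm_sum_le _ _).trans ?_
    rw [← nsmul_eq_mul, ← Finset.card_univ]
    refine Finset.sum_le_card_nsmul _ _ _ fun k _ => ?_
    rw [Matrix.vecMulVec_apply, norm_mul, Pi.star_apply, norm_star]
    exact mul_le_mul (hC _ _) (hC _ _) (norm_nonneg _) ((norm_nonneg _).trans (hC (Y k) i))
  obtain ⟨Y₀, hY₀⟩ := exists_isUnit_det_frameMatrix v hsep
  have hpos : 0 < ⨆ Y, F Y := by
    refine lt_of_lt_of_le (lt_of_le_of_ne (hF0 Y₀) fun h => hY₀ ?_) (le_ciSup hbdd Y₀)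
    rw [hFdet, ← h, Complex.ofReal_zero]
  set n : ℝ := (Fintype.card ι : ℝ) with hn
  have hn0 : 0 < n := by rw [hn]; exact_mod_cast Fintype.card_pos
  have hε : 0 < 1 / (2 * n) := by positivity
  have : Nonempty (ι ⊕ ι → D) := ⟨Y₀⟩
  -- The supremum need not be attained, so a near-maximizer is used; the slack `1/(2n)` per exchange
  -- adds up to 1 over `2 n` exchanges.
  obtain ⟨Y, hY⟩ := exists_lt_of_lt_ciSup (f := F)
    (div_lt_self hpos (by linarith : 1 < 1 + 1 / (2 * n)))
  have hFY : 0 < F Y := lt_trans (by positivity) hY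
  have hunit : IsUnit (frameMatrix (v ∘ Y)).det := by
    rw [hFdet, isUnit_iff_ne_zero]
    exact_mod_cast hFY.ne'
  refine ⟨Y, fun x => ⟨fun k => star (v (Y k)) ⬝ᵥ (frameMatrix (v ∘ Y))⁻¹ *ᵥ v x,
    (sum_star_dotProduct_inv_smul (v ∘ Y) hunit (v x)).symm, ?_⟩⟩
  set A := frameMatrix (v ∘ Y) with hA
  have ht := sum_norm_sq_star_dotProduct_inv (v ∘ Y) hunit (v x)
  set t := ∑ k, ‖star ((v ∘ Y) k) ⬝ᵥ (frameMatrix (v ∘ Y))⁻¹ *ᵥ v x‖ ^ 2 with htdef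
  change t ≤ 1
  set τ : ι ⊕ ι → ℝ := fun k => (star (v (Y k)) ⬝ᵥ A⁻¹ *ᵥ v (Y k)).re with hτ
  have hτC : ∀ k, star (v (Y k)) ⬝ᵥ A⁻¹ *ᵥ v (Y k) = (τ k : ℂ) := fun k => by
    have := sum_norm_sq_star_dotProduct_inv (v ∘ Y) hunit (v (Y k))
    rw [hτ]
    simp only
    rw [hA, ← this, Complex.ofReal_re]
  have hτsum : ∑ k, τ k = n := by
    have := sum_star_dotProduct_inv_mulVec (v ∘ Y) hunit
    have h2 : ((∑ k, τ k : ℝ) : ℂ) = (n : ℂ) := by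
      rw [hn]
      push_cast
      rw [← this]
      exact Finset.sum_congr rfl fun k _ => (hτC k).symm
    exact_mod_cast h2
  have hex : ∀ k, (1 - τ k) * (1 + t) + ‖star ((v ∘ Y) k) ⬝ᵥ A⁻¹ *ᵥ v x‖ ^ 2 ≤
      1 + 1 / (2 * n) := by
    intro k
    have h1 : F (Function.update Y k x) = F Y *
        ((1 - τ k) * (1 + t) + ‖star ((v ∘ Y) k) ⬝ᵥ A⁻¹ *ᵥ v x‖ ^ 2) := by
      have h2 : v ∘ Function.update Y k x = Function.update (v ∘ Y) k (v x) :=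
        Function.comp_update v Y k x
      have h3 := hFdet (Function.update Y k x)
      rw [h2, frameMatrix_update, det_sub_vecMulVec_add_vecMulVec _ hunit, hFdet, ← ht,
        star_dotProduct_inv_mulVec_comm (v ∘ Y) ((v ∘ Y) k) (v x)] at h3
      have h4 : ∀ z : ℂ, z * star z = ((‖z‖ ^ 2 : ℝ) : ℂ) := fun z => by
        rw [RCLike.star_def, Complex.mul_conj']
        push_cast
        rfl
      rw [h4, Function.comp_apply, hτC] at h3
      exact_mod_cast h3.symm
    have h2 : F (Function.update Y k x) ≤ F Y * (1 + 1 / (2 * n)) :=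
      (le_ciSup hbdd _).trans ((div_lt_iff₀ (by linarith)).1 hY).le
    rw [h1] at h2
    exact le_of_mul_le_mul_left h2 hFY
  -- Since `∑ τ = n` and the squared coefficients sum to `t`, adding all exchanges gives `n(1 + t) +
  -- t ≤ 2n + 1`, that is `t ≤ 1`.
  have hsum := Finset.sum_le_sum fun k (_ : k ∈ Finset.univ) => hex k
  rw [Finset.sum_add_distrib, ← Finset.sum_mul, Finset.sum_sub_distrib, hτsum, Finset.sum_const,
    Finset.sum_const, Finset.card_univ, Fintype.card_sum, nsmul_eq_mul, nsmul_eq_mul] at hsum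
  push_cast at hsum
  rw [← hn, ← htdef] at hsum
  have : (n + n) * (1 + 1 / (2 * n)) = 2 * n + 1 := by field_simp; ring
  nlinarith

/-! ### Discrete least squares -/

section SampleNorm

variable {D : Type*} {m : ℕ}

/-- Sampling at the points `X`, as a linear map into Euclidean space. -/
noncomputable def sampleMap (X : Fin m → D) : (D → ℂ) →ₗ[ℂ] EuclideanSpace ℂ (Fin m) where
  toFun f := WithLp.toLp 2 (f ∘ X)
  map_add' _ _ := rfl
  map_smul' _ _ := rfl

lemma sampleNorm_eq (X : Fin m → D) (f : D → ℂ) :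
    sampleNorm X f = √(1 / (m : ℝ)) * ‖sampleMap X f‖ := by
  rw [sampleNorm, Real.sqrt_mul (by positivity), EuclideanSpace.norm_eq]
  rfl

lemma sampleNorm_nonneg (X : Fin m → D) (f : D → ℂ) : 0 ≤ sampleNorm X f := Real.sqrt_nonneg _

lemma sampleNorm_sq (X : Fin m → D) (f : D → ℂ) :
    sampleNorm X f ^ 2 = (1 / (m : ℝ)) * ∑ i, ‖f (X i)‖ ^ 2 :=
  Real.sq_sqrt (by positivity)

lemma sampleNorm_add_le (X : Fin m → D) (f g : D → ℂ) :
    sampleNorm X (f + g) ≤ sampleNorm X f + sampleNorm X g := by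
  simp only [sampleNorm_eq, map_add, ← mul_add]
  exact mul_le_mul_of_nonneg_left (norm_add_le _ _) (Real.sqrt_nonneg _)

lemma sampleNorm_sub_comm (X : Fin m → D) (f g : D → ℂ) :
    sampleNorm X (f - g) = sampleNorm X (g - f) := by
  simp only [sampleNorm_eq, map_sub, norm_sub_rev]

lemma sampleNorm_le (X : Fin m → D) (f : D → ℂ) {C : ℝ} (hC0 : 0 ≤ C) (hC : ∀ x, ‖f x‖ ≤ C) :
    sampleNorm X f ≤ C := by
  refine Real.sqrt_le_iff.2 ⟨hC0, ?_⟩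
  have h : ∑ i, ‖f (X i)‖ ^ 2 ≤ m * C ^ 2 := by
    have := Finset.sum_le_card_nsmul Finset.univ (fun i => ‖f (X i)‖ ^ 2) (C ^ 2) fun i _ =>
      pow_le_pow_left₀ (norm_nonneg _) (hC (X i)) 2
    simpa using this
  rcases Nat.eq_zero_or_pos m with rfl | hm
  · simpa using sq_nonneg C
  · have hm' : (0 : ℝ) < m := by exact_mod_cast hm
    rw [one_div, inv_mul_le_iff₀ hm']
    exact h

/-- The minimizer is a preimage in `V` of the orthogonal projection of the samples of `f` onto those
of `V`. Pythagoras gives minimality and shows that two minimizers agree at the sample points, hence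
everywhere by `hX`. -/
lemma existsUnique_isLeastSquaresFit (hm : 0 < m) (X : Fin m → D) (V : Submodule ℂ (D → ℂ))
    [FiniteDimensional ℂ V] (hX : ∀ g ∈ V, sampleNorm X g = 0 → g = 0) (f : D → ℂ) :
    ∃! g, IsLeastSquaresFit X V f g := by
  have hc : 0 < √(1 / (m : ℝ)) := Real.sqrt_pos.2 (by positivity)
  set K := V.map (sampleMap X) with hK
  set y := sampleMap X f with hy
  obtain ⟨g₀, hg₀, hg₀p⟩ := Submodule.mem_map.1 (K.starProjection_apply_mem y)
  have hpyth : ∀ h ∈ V, ‖sampleMap X (h - f)‖ ^ 2 =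
      ‖sampleMap X (h - g₀)‖ ^ 2 + ‖sampleMap X (g₀ - f)‖ ^ 2 := by
    intro h hh
    have horth : inner ℂ (sampleMap X (h - g₀)) (sampleMap X (g₀ - f)) = 0 := by
      rw [map_sub _ g₀, hg₀p, ← neg_sub y, inner_neg_right, neg_eq_zero]
      exact (Submodule.mem_orthogonal _ _).1 (K.sub_starProjection_mem_orthogonal y) _
        (Submodule.mem_map_of_mem (V.sub_mem hh hg₀))
    have hadd : sampleMap X (h - f) = sampleMap X (h - g₀) + sampleMap X (g₀ - f) := by
      rw [← map_add, sub_add_sub_cancel]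
    rw [hadd, sq, sq, sq, norm_add_sq_eq_norm_sq_add_norm_sq_of_inner_eq_zero _ _ horth]
  refine ⟨g₀, ⟨hg₀, fun h hh => ?_⟩, fun g ⟨hg, hmin⟩ => ?_⟩
  · rw [sampleNorm_eq, sampleNorm_eq]
    refine mul_le_mul_of_nonneg_left ((sq_le_sq₀ (norm_nonneg _) (norm_nonneg _)).1 ?_)
      hc.le
    rw [hpyth h hh]
    exact le_add_of_nonneg_left (sq_nonneg _)
  · have h1 := hmin g₀ hg₀
    rw [sampleNorm_eq, sampleNorm_eq] at h1
    have h2 := pow_le_pow_left₀ (norm_nonneg _) (le_of_mul_le_mul_left h1 hc) 2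
    rw [hpyth g hg] at h2
    have h3 : ‖sampleMap X (g - g₀)‖ = 0 := by nlinarith [norm_nonneg (sampleMap X (g - g₀))]
    exact sub_eq_zero.1 (hX _ (V.sub_mem hg hg₀) (by rw [sampleNorm_eq, h3, mul_zero]))

lemma isLeastSquaresFit_leastSquares (X : Fin m → D) (V : Submodule ℂ (D → ℂ)) (f : D → ℂ)
    (h : ∃ g, IsLeastSquaresFit X V f g) : IsLeastSquaresFit X V f (leastSquares X V f) := by
  rw [leastSquares, dif_pos h]
  exact h.choose_spec

end SampleNorm

/-! ### Discretization of the `L²` and uniform norms -/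

section BoundedMeasurable

variable {D : Type*} [MeasurableSpace D]

lemma integrable_mul_conj_of_mem {f g : D → ℂ} (hf : f ∈ boundedMeasurableFunctions D)
    (hg : g ∈ boundedMeasurableFunctions D) (ρ : Measure D) [IsFiniteMeasure ρ] :
    Integrable (fun x => (starRingEnd ℂ) (f x) * g x) ρ := by
  obtain ⟨⟨C, hC⟩, hfm⟩ := hf
  obtain ⟨⟨C', hC'⟩, hgm⟩ := hg
  refine Integrable.of_bound (C := C * C')
    ((Complex.continuous_conj.measurable.comp hfm).mul hgm).aestronglyMeasurable
    (Filter.Eventually.of_forall fun x => ?_)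
  rw [norm_mul, RCLike.norm_conj]
  exact mul_le_mul (hC x) (hC' x) (norm_nonneg _) ((norm_nonneg _).trans (hC x))

lemma integrable_norm_sq_of_mem {f : D → ℂ} (hf : f ∈ boundedMeasurableFunctions D)
    (ρ : Measure D) [IsFiniteMeasure ρ] : Integrable (fun x => ‖f x‖ ^ 2) ρ := by
  have := (integrable_mul_conj_of_mem hf hf ρ).re
  refine this.congr (Filter.Eventually.of_forall fun x => ?_)
  simp only [Complex.conj_mul']
  norm_cast

lemma integral_conj_mul_self (f : D → ℂ) (ρ : Measure D) :
    ∫ x, (starRingEnd ℂ) (f x) * f x ∂ρ = ((∫ x, ‖f x‖ ^ 2 ∂ρ : ℝ) : ℂ) := by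
  rw [← integral_complex_ofReal]
  refine integral_congr_ae (Filter.Eventually.of_forall fun x => ?_)
  simp only [Complex.conj_mul']
  norm_cast

/-- A finite-dimensional space of bounded measurable functions on which the `L²`-seminorm is a norm
has an `L²`-orthonormal basis. -/
lemma exists_isometric_coordinates (ρ : Measure D) [IsFiniteMeasure ρ] {n : ℕ}
    (V : Submodule ℂ (D → ℂ)) (hV : V ≤ boundedMeasurableFunctions D)
    [FiniteDimensional ℂ V] (hdim : Module.finrank ℂ V = n)
    (hρ : ∀ g ∈ V, ∫ x, ‖g x‖ ^ 2 ∂ρ = 0 → g = 0) :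
    ∃ v : D → Fin n → ℂ, (∀ c : Fin n → ℂ, (fun x => c ⬝ᵥ v x) ∈ V) ∧
      (∀ g ∈ V, ∃ c : Fin n → ℂ, ∀ x, g x = c ⬝ᵥ v x) ∧
      ∀ c : Fin n → ℂ, ∫ x, ‖c ⬝ᵥ v x‖ ^ 2 ∂ρ = ∑ i, ‖c i‖ ^ 2 := by
  let core : InnerProductSpace.Core ℂ V :=
    { inner := fun f g => ∫ x, (starRingEnd ℂ) ((f : D → ℂ) x) * (g : D → ℂ) x ∂ρ
      conj_inner_symm := fun f g => by
        rw [← integral_conj]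
        simp [mul_comm]
      re_inner_nonneg := fun f => by
        rw [integral_conj_mul_self]
        simpa using integral_nonneg fun x => sq_nonneg ‖(f : D → ℂ) x‖
      add_left := fun f g h => by
        rw [← integral_add (integrable_mul_conj_of_mem (hV f.2) (hV h.2) ρ)
          (integrable_mul_conj_of_mem (hV g.2) (hV h.2) ρ)]
        simp [add_mul]
      smul_left := fun f g r => by
        rw [← integral_const_mul]
        simp [mul_assoc]
      definite := fun f hf => by
        rw [integral_conj_mul_self] at hf
        exact Subtype.ext (hρ f f.2 (by exact_mod_cast hf)) }
  let : NormedAddCommGroup V := core.toNormedAddCommGroup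
  let : InnerProductSpace ℂ V := InnerProductSpace.ofCore core.toCore
  let b : OrthonormalBasis (Fin n) ℂ V := (stdOrthonormalBasis ℂ V).reindex (finCongr hdim)
  have hcoe : ∀ (c : Fin n → ℂ) x, ((∑ i, c i • b i : V) : D → ℂ) x =
      c ⬝ᵥ fun i => (b i : D → ℂ) x := fun c x => by
    simp [dotProduct]
  refine ⟨fun x i => (b i : D → ℂ) x, fun c => ?_, fun g hg => ?_, fun c => ?_⟩
  · have : (fun x => c ⬝ᵥ fun i => (b i : D → ℂ) x) = ((∑ i, c i • b i : V) : D → ℂ) :=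
      funext fun x => (hcoe c x).symm
    rw [this]
    exact Subtype.prop _
  · refine ⟨b.repr ⟨g, hg⟩, fun x => ?_⟩
    rw [← hcoe, b.sum_repr]
  · have h1 : inner ℂ (∑ i, c i • b i) (∑ i, c i • b i) =
        ((∫ x, ‖((∑ i, c i • b i : V) : D → ℂ) x‖ ^ 2 ∂ρ : ℝ) : ℂ) :=
      integral_conj_mul_self _ ρ
    rw [b.orthonormal.inner_sum] at h1
    simp only [hcoe] at h1
    have h2 : ((∑ i, ‖c i‖ ^ 2 : ℝ) : ℂ) =
        ((∫ x, ‖c ⬝ᵥ fun i => (b i : D → ℂ) x‖ ^ 2 ∂ρ : ℝ) : ℂ) := by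
      rw [← h1]
      push_cast
      exact Finset.sum_congr rfl fun i _ => (Complex.conj_mul' _).symm
    exact_mod_cast h2.symm

/-- Unweighted discretization of the `L²`-norm from below, with oversampling factor four. -/
lemma exists_points_integral_le (ρ : Measure D) [IsProbabilityMeasure ρ] {n : ℕ} (hn : 1 ≤ n)
    (V : Submodule ℂ (D → ℂ)) (hV : V ≤ boundedMeasurableFunctions D)
    [FiniteDimensional ℂ V] (hdim : Module.finrank ℂ V = n)
    (hρ : ∀ g ∈ V, ∫ x, ‖g x‖ ^ 2 ∂ρ = 0 → g = 0) :
    ∃ X : Fin (4 * n) → D, ∀ g ∈ V, ∫ x, ‖g x‖ ^ 2 ∂ρ ≤ 4 * sampleNorm X g ^ 2 := by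
  obtain ⟨v, hvV, hrep, hiso⟩ := exists_isometric_coordinates ρ V hV hdim hρ
  have h := exists_points_frame_le ρ v (fun c => integrable_norm_sq_of_mem (hV (hvV c)) ρ) hiso
  rw [Fintype.card_fin] at h
  obtain ⟨X, hX⟩ := h
  refine ⟨X, fun g hg => ?_⟩
  obtain ⟨c, hc⟩ := hrep g hg
  have hn0 : (0 : ℝ) < n := by exact_mod_cast hn
  rw [sampleNorm_sq]
  simp only [hc]
  rw [hiso]
  have := hX c
  push_cast
  rw [one_div, mul_inv, ← mul_assoc, ← mul_assoc, mul_inv_cancel₀ four_ne_zero, one_mul,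
    le_inv_mul_iff₀ hn0]
  exact this

/-- The uniform norm on an `n`-dimensional space is controlled by the values at `2 n` points. -/
lemma exists_points_norm_sq_le_sum {D : Type*} {n : ℕ} (hn : 1 ≤ n) (V : Submodule ℂ (D → ℂ))
    (hV : V ≤ boundedFunctions D) [FiniteDimensional ℂ V] (hdim : Module.finrank ℂ V = n) :
    ∃ Y : Fin n ⊕ Fin n → D, ∀ g ∈ V, ∀ x, ‖g x‖ ^ 2 ≤ ∑ k, ‖g (Y k)‖ ^ 2 := by
  have : Nonempty (Fin n) := ⟨⟨0, hn⟩⟩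
  let b : Module.Basis (Fin n) ℂ V := Module.finBasisOfFinrankEq ℂ V hdim
  set v : D → Fin n → ℂ := fun x i => (b i : D → ℂ) x with hv
  have hcoe : ∀ (c : Fin n → ℂ) x, ((∑ i, c i • b i : V) : D → ℂ) x = c ⬝ᵥ v x := fun c x => by
    simp [dotProduct, hv]
  choose C hC using fun i => hV (b i).2
  obtain ⟨Y, hY⟩ := exists_design v (∑ i, |C i|)
    (fun x i => (hC i x).trans ((le_abs_self _).trans
      (Finset.single_le_sum (f := fun i => |C i|) (fun j _ => abs_nonneg _) (Finset.mem_univ i))))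
    (fun c hc => by
      have h0 : ∑ i, c i • b i = 0 := Subtype.ext (funext fun x => (hcoe c x).trans (hc x))
      exact funext fun i => Fintype.linearIndependent_iff.1 b.linearIndependent c h0 i)
  refine ⟨Y, fun g hg x => ?_⟩
  obtain ⟨a, ha, ha1⟩ := hY x
  have hg' : ∀ z, g z = (b.repr ⟨g, hg⟩ : Fin n → ℂ) ⬝ᵥ v z := fun z => by
    rw [← hcoe, b.sum_repr]
  have hgx : g x = ∑ k, a k * g (Y k) := by
    rw [hg' x, ha, dotProduct_sum]
    refine Finset.sum_congr rfl fun k _ => ?_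
    rw [dotProduct_smul, ← hg', smul_eq_mul]
  calc ‖g x‖ ^ 2 ≤ (∑ k, ‖a k‖ * ‖g (Y k)‖) ^ 2 := by
        refine pow_le_pow_left₀ (norm_nonneg _) ?_ 2
        rw [hgx]
        exact (norm_sum_le _ _).trans_eq (Finset.sum_congr rfl fun k _ => norm_mul _ _)
    _ ≤ (∑ k, ‖a k‖ ^ 2) * ∑ k, ‖g (Y k)‖ ^ 2 := Finset.sum_mul_sq_le_sq_mul_sq _ _ _
    _ ≤ ∑ k, ‖g (Y k)‖ ^ 2 :=
        mul_le_of_le_one_left (Finset.sum_nonneg fun _ _ => sq_nonneg _) ha1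

/-! ### Combining both norms through an averaged measure -/

/-- The average of `μ` with the uniform distribution on a finite family of points. -/
noncomputable def averagedMeasure {κ : Type*} [Fintype κ] (μ : Measure D) (Y : κ → D) :
    Measure D :=
  (2 : ℝ≥0∞)⁻¹ • (μ + (Fintype.card κ : ℝ≥0∞)⁻¹ • ∑ k, Measure.dirac (Y k))

instance averagedMeasure_isProbabilityMeasure {κ : Type*} [Fintype κ] [Nonempty κ] (μ : Measure D)
    [IsProbabilityMeasure μ] (Y : κ → D) : IsProbabilityMeasure (averagedMeasure μ Y) := by
  constructor
  have : (Fintype.card κ : ℝ≥0∞) ≠ 0 := by exact_mod_cast Fintype.card_ne_zero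
  simp only [averagedMeasure, Measure.smul_apply, Measure.add_apply, measure_univ,
    Measure.finsetSum_apply, smul_eq_mul, Finset.sum_const, Finset.card_univ, nsmul_eq_mul, mul_one]
  rw [ENNReal.inv_mul_cancel this (ENNReal.natCast_ne_top _), one_add_one_eq_two,
    ENNReal.inv_mul_cancel two_ne_zero ENNReal.ofNat_ne_top]

lemma integral_averagedMeasure {κ : Type*} [Fintype κ] [Nonempty κ] (μ : Measure D)
    [IsProbabilityMeasure μ] (Y : κ → D) {g : D → ℂ} (hg : g ∈ boundedMeasurableFunctions D) :
    ∫ x, ‖g x‖ ^ 2 ∂(averagedMeasure μ Y) =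
      (∫ x, ‖g x‖ ^ 2 ∂μ + (Fintype.card κ : ℝ)⁻¹ * ∑ k, ‖g (Y k)‖ ^ 2) / 2 := by
  have hc : (Fintype.card κ : ℝ≥0∞) ≠ 0 := by exact_mod_cast Fintype.card_ne_zero
  have hdirac : ∀ k, Integrable (fun x => ‖g x‖ ^ 2) (Measure.dirac (Y k)) := fun k =>
    integrable_norm_sq_of_mem hg _
  have hsm : StronglyMeasurable fun x => ‖g x‖ ^ 2 := (hg.2.norm.pow_const 2).stronglyMeasurable
  rw [averagedMeasure, integral_smul_measure, integral_add_measure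
    (integrable_norm_sq_of_mem hg μ) (Integrable.smul_measure
      (integrable_finsetSum_measure.2 fun k _ => hdirac k) (ENNReal.inv_ne_top.2 hc)),
    integral_smul_measure, integral_finsetSum_measure fun k _ => hdirac k]
  simp only [integral_dirac' _ _ hsm, ENNReal.toReal_inv, ENNReal.toReal_natCast,
    ENNReal.toReal_ofNat, smul_eq_mul]
  ring

/-- One family of `4 n` points controls both the `L²`-norm and the uniform norm. -/
lemma exists_points_norm_le (μ : Measure D) [IsProbabilityMeasure μ] {n : ℕ} (hn : 1 ≤ n)
    (V : Submodule ℂ (D → ℂ)) (hV : V ≤ boundedMeasurableFunctions D)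
    [FiniteDimensional ℂ V] (hdim : Module.finrank ℂ V = n) :
    ∃ X : Fin (4 * n) → D, ∀ g ∈ V, ∫ x, ‖g x‖ ^ 2 ∂μ ≤ (4 * sampleNorm X g) ^ 2 ∧
      ∀ x, ‖g x‖ ≤ √n * (4 * sampleNorm X g) := by
  have : Nonempty (Fin n) := ⟨⟨0, hn⟩⟩
  have hn0 : (0 : ℝ) < n := by exact_mod_cast hn
  obtain ⟨Y, hY⟩ := exists_points_norm_sq_le_sum hn V (fun g hg => (hV hg).1) hdim
  have hint : ∀ g ∈ V, ∫ x, ‖g x‖ ^ 2 ∂(averagedMeasure μ Y) =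
      (∫ x, ‖g x‖ ^ 2 ∂μ + (2 * n : ℝ)⁻¹ * ∑ k, ‖g (Y k)‖ ^ 2) / 2 := fun g hg => by
    rw [integral_averagedMeasure μ Y (hV hg), Fintype.card_sum, Fintype.card_fin, ← two_mul]
    push_cast
    rfl
  have hμ0 : ∀ g : D → ℂ, 0 ≤ ∫ x, ‖g x‖ ^ 2 ∂μ := fun g => integral_nonneg fun x => sq_nonneg _
  have hY0 : ∀ g : D → ℂ, 0 ≤ ∑ k, ‖g (Y k)‖ ^ 2 := fun g =>
    Finset.sum_nonneg fun _ _ => sq_nonneg _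
  have hsup : ∀ g ∈ V, ∀ x, ‖g x‖ ^ 2 ≤ 4 * n * ∫ x, ‖g x‖ ^ 2 ∂(averagedMeasure μ Y) := by
    intro g hg x
    have h1 : 4 * n * ∫ x, ‖g x‖ ^ 2 ∂(averagedMeasure μ Y) =
        2 * n * ∫ x, ‖g x‖ ^ 2 ∂μ + ∑ k, ‖g (Y k)‖ ^ 2 := by
      rw [hint g hg]
      field_simp
      ring
    have h2 : 0 ≤ 2 * n * ∫ x, ‖g x‖ ^ 2 ∂μ := mul_nonneg (by positivity) (hμ0 g)
    linarith [hY g hg x]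
  -- The `L²(μ)` seminorm may degenerate on `V`; that of the averaged measure cannot, because it
  -- controls the uniform norm.
  obtain ⟨X, hX⟩ := exists_points_integral_le (averagedMeasure μ Y) hn V hV hdim fun g hg h => by
    funext x
    have := hsup g hg x
    rw [h, mul_zero] at this
    exact norm_eq_zero.1 (pow_eq_zero_iff two_ne_zero |>.1 (le_antisymm this (sq_nonneg _)))
  refine ⟨X, fun g hg => ⟨?_, fun x => ?_⟩⟩
  -- Here `∫ |g|² dμ ≤ 2 ∫ |g|² dρ ≤ 8 ‖g‖_X²`, rounded up to 16 to match the constant `4n · 4` of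
  -- the uniform bound.
  · have h1 := hX g hg
    rw [hint g hg] at h1
    have h2 : 0 ≤ (2 * n : ℝ)⁻¹ * ∑ k, ‖g (Y k)‖ ^ 2 := mul_nonneg (by positivity) (hY0 g)
    nlinarith [sq_nonneg (sampleNorm X g)]
  · have hs := sampleNorm_nonneg X g
    refine (sq_le_sq₀ (norm_nonneg _) (by positivity)).1 ?_
    rw [mul_pow, Real.sq_sqrt hn0.le]
    refine (hsup g hg x).trans ?_
    have := mul_le_mul_of_nonneg_left (hX g hg) hn0.le
    nlinarith

/-! ### Passage to `L_p` and the main theorem -/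

/-- Interpolation between an `L²`-bound and a uniform bound. -/
lemma eLpNorm_le_of_integral_sq_le {μ : Measure D} [IsProbabilityMeasure μ] {u : D → ℂ}
    (hu : Measurable u) {N A : ℝ} (hN : 1 ≤ N) (hA : 0 ≤ A)
    (hi : Integrable (fun x => ‖u x‖ ^ 2) μ) (h2 : ∫ x, ‖u x‖ ^ 2 ∂μ ≤ A ^ 2)
    (hsup : ∀ x, ‖u x‖ ≤ √N * A) {p : ℝ≥0∞} :
    eLpNorm u p μ ≤ ENNReal.ofReal (N ^ max (1 / 2 - (p⁻¹).toReal) 0 * A) := by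
  have hN0 : 0 < N := by linarith
  have hl2 : ∫⁻ x, ‖u x‖ₑ ^ (2 : ℝ) ∂μ ≤ ENNReal.ofReal (A ^ 2) := by
    calc ∫⁻ x, ‖u x‖ₑ ^ (2 : ℝ) ∂μ = ∫⁻ x, ENNReal.ofReal (‖u x‖ ^ 2) ∂μ := by
          refine lintegral_congr fun x => ?_
          rw [ENNReal.rpow_two, ENNReal.ofReal_pow (norm_nonneg _), ofReal_norm]
      _ = ENNReal.ofReal (∫ x, ‖u x‖ ^ 2 ∂μ) :=
          (ofReal_integral_eq_lintegral_ofReal hi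
            (Filter.Eventually.of_forall fun x => sq_nonneg _)).symm
      _ ≤ ENNReal.ofReal (A ^ 2) := ENNReal.ofReal_le_ofReal h2
  rcases le_or_gt p 2 with hp | hp
  · refine (eLpNorm_le_eLpNorm_of_exponent_le hp hu.aestronglyMeasurable).trans ?_
    rw [eLpNorm_eq_lintegral_rpow_enorm_toReal two_ne_zero ENNReal.ofNat_ne_top,
      ENNReal.toReal_ofNat]
    refine (ENNReal.rpow_le_rpow hl2 (by norm_num)).trans ?_
    rw [ENNReal.ofReal_rpow_of_nonneg (sq_nonneg _) (by norm_num), ← Real.sqrt_eq_rpow,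
      Real.sqrt_sq hA]
    exact ENNReal.ofReal_le_ofReal
      (le_mul_of_one_le_left hA (Real.one_le_rpow hN (le_max_right _ _)))
  · rcases eq_or_ne p ∞ with rfl | hp_top
    · have h := eLpNorm_le_of_ae_bound (p := ∞) (μ := μ) (Filter.Eventually.of_forall hsup)
      simpa [Real.sqrt_eq_rpow] using h
    set q := p.toReal with hq
    have hq2 : 2 < q := by
      have := (ENNReal.toReal_lt_toReal ENNReal.ofNat_ne_top hp_top).2 hp
      simpa using this
    have hexp : max (1 / 2 - (p⁻¹).toReal) 0 = 1 / 2 - 1 / q := by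
      rw [ENNReal.toReal_inv, ← hq, one_div q, max_eq_left]
      have : q⁻¹ ≤ 2⁻¹ := inv_anti₀ two_pos hq2.le
      linarith
    rw [hexp, eLpNorm_eq_lintegral_rpow_enorm_toReal (by positivity) hp_top, ← hq, one_div q,
      ENNReal.rpow_inv_le_iff (by linarith),
      ENNReal.ofReal_rpow_of_nonneg (by positivity) (by linarith)]
    have hR : 0 ≤ √N * A := by positivity
    -- For `2 < q < ∞`, write `|u|^q = |u|^(q-2) |u|²`: the first factor is bounded uniformly, the
    -- second in mean.
    calc ∫⁻ x, ‖u x‖ₑ ^ q ∂μ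
        ≤ ∫⁻ x, ENNReal.ofReal ((√N * A) ^ (q - 2)) * ‖u x‖ₑ ^ (2 : ℝ) ∂μ := by
          refine lintegral_mono fun x => ?_
          have : q = (q - 2) + 2 := by ring
          conv_lhs => rw [this, ENNReal.rpow_add_of_nonneg _ _ (by linarith) (by norm_num)]
          gcongr
          rw [← ENNReal.ofReal_rpow_of_nonneg hR (by linarith)]
          refine ENNReal.rpow_le_rpow ?_ (by linarith)
          rw [← ofReal_norm]
          exact ENNReal.ofReal_le_ofReal (hsup x)
      _ = ENNReal.ofReal ((√N * A) ^ (q - 2)) * ∫⁻ x, ‖u x‖ₑ ^ (2 : ℝ) ∂μ :=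
          lintegral_const_mul' _ _ ENNReal.ofReal_ne_top
      _ ≤ ENNReal.ofReal ((√N * A) ^ (q - 2)) * ENNReal.ofReal (A ^ 2) := by gcongr
      _ = ENNReal.ofReal ((N ^ (1 / 2 - q⁻¹) * A) ^ q) := by
          rw [← ENNReal.ofReal_mul (by positivity)]
          congr 1
          rw [Real.mul_rpow (Real.sqrt_nonneg _) hA, Real.mul_rpow (by positivity) hA,
            mul_assoc, ← Real.rpow_two, ← Real.rpow_add_of_nonneg hA (by linarith) (by norm_num),
            sub_add_cancel, Real.sqrt_eq_rpow, ← Real.rpow_mul hN0.le, ← Real.rpow_mul hN0.le]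
          congr 2
          have : q ≠ 0 := by positivity
          field_simp

end BoundedMeasurable

theorem theorem4p3 {D : Type*} [MeasurableSpace D] (μ : Measure D) [IsProbabilityMeasure μ]
    (n : ℕ) (hn : 1 ≤ n) (V : Submodule ℂ (D → ℂ)) (hV : V ≤ boundedMeasurableFunctions D)
    (hdim : Module.finrank ℂ V = n) :
    ∃ X : Fin (4 * n) → D,
      (∀ g ∈ V, sampleNorm X g = 0 → g = 0) ∧
      (∀ f ∈ boundedFunctions D, ∃! g, IsLeastSquaresFit X V f g) ∧
      ∀ f ∈ boundedMeasurableFunctions D, ∀ p : ℝ≥0∞, 1 ≤ p →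
        eLpNorm (f - leastSquares X V f) p μ ≤
          ENNReal.ofReal
            (84 * (n : ℝ) ^ max (1 / 2 - (p⁻¹).toReal) 0 * bestUniformError V f) := by
  -- `finrank` is 0 in infinite dimension, so `n ≥ 1` forces finite dimension.
  have : FiniteDimensional ℂ V := FiniteDimensional.of_finrank_pos (by omega)
  have hn1 : (1 : ℝ) ≤ n := by exact_mod_cast hn
  obtain ⟨X, hX⟩ := exists_points_norm_le μ hn V hV hdim
  have hnorm : ∀ g ∈ V, sampleNorm X g = 0 → g = 0 := fun g hg h => by
    funext x
    have := (hX g hg).2 x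
    rw [h, mul_zero, mul_zero] at this
    exact norm_le_zero_iff.1 this
  have hfit := existsUnique_isLeastSquaresFit (by omega) X V hnorm
  refine ⟨X, hnorm, fun f _ => hfit f, fun f hf p hp => ?_⟩
  obtain ⟨hAV, hAmin⟩ := isLeastSquaresFit_leastSquares X V f (hfit f).exists
  set A := leastSquares X V f with hA
  set c : ℝ := (n : ℝ) ^ max (1 / 2 - (p⁻¹).toReal) 0 with hc
  have hc1 : 1 ≤ c := Real.one_le_rpow hn1 (le_max_right _ _)
  have hmain : ∀ g ∈ V, eLpNorm (f - A) p μ ≤ ENNReal.ofReal (84 * c * supNorm (f - g)) := by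
    intro g hg
    set E := supNorm (f - g) with hE
    have hE0 : 0 ≤ E := Real.iSup_nonneg fun x => norm_nonneg _
    have hfg : f - g ∈ boundedMeasurableFunctions D := Submodule.sub_mem _ hf (hV hg)
    have hbound : ∀ x, ‖(f - g) x‖ ≤ E := fun x => by
      obtain ⟨C, hC⟩ := hfg.1
      exact le_ciSup (f := fun x => ‖(f - g) x‖) ⟨C, by rintro _ ⟨x, rfl⟩; exact hC x⟩ x
    have hgA : g - A ∈ V := V.sub_mem hg hAV
    have hs : sampleNorm X (g - A) ≤ 2 * E := by
      have h1 : sampleNorm X (f - g) ≤ E := sampleNorm_le X _ hE0 hbound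
      have h2 := sampleNorm_add_le X (g - f) (f - A)
      rw [sub_add_sub_cancel, sampleNorm_sub_comm X f A, sampleNorm_sub_comm X g f] at h2
      have h3 := hAmin g hg
      rw [sampleNorm_sub_comm X g f] at h3
      linarith
    have h1 : eLpNorm (f - g) p μ ≤ ENNReal.ofReal E := by
      have h := eLpNorm_le_of_ae_bound (p := p) (μ := μ) (Filter.Eventually.of_forall hbound)
      simpa using h
    have h2 : eLpNorm (g - A) p μ ≤ ENNReal.ofReal (c * (4 * sampleNorm X (g - A))) :=
      eLpNorm_le_of_integral_sq_le (hV hgA).2 hn1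
        (mul_nonneg four_pos.le (sampleNorm_nonneg _ _))
        (integrable_norm_sq_of_mem (hV hgA) μ) (hX _ hgA).1 (hX _ hgA).2
    calc eLpNorm (f - A) p μ = eLpNorm ((f - g) + (g - A)) p μ := by rw [sub_add_sub_cancel]
      _ ≤ eLpNorm (f - g) p μ + eLpNorm (g - A) p μ :=
          eLpNorm_add_le hfg.2.aestronglyMeasurable (hV hgA).2.aestronglyMeasurable hp
      _ ≤ ENNReal.ofReal E + ENNReal.ofReal (c * (4 * sampleNorm X (g - A))) := add_le_add h1 h2
      _ = ENNReal.ofReal (E + c * (4 * sampleNorm X (g - A))) :=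
          (ENNReal.ofReal_add hE0 (mul_nonneg (by linarith)
            (mul_nonneg four_pos.le (sampleNorm_nonneg _ _)))).symm
      -- As `c ≥ 1`, the total `1 + 8c` is at most `9c`, well below `84c`.
      _ ≤ ENNReal.ofReal (84 * c * E) := by
          refine ENNReal.ofReal_le_ofReal ?_
          have h3 : c * (4 * sampleNorm X (g - A)) ≤ c * (8 * E) :=
            mul_le_mul_of_nonneg_left (by linarith) (by linarith)
          nlinarith
  -- Finiteness, from the competitor `g = 0`, allows the infimum over `g` to be taken in the reals.
  have hfin : eLpNorm (f - A) p μ ≠ ∞ := ne_top_of_le_ne_top ENNReal.ofReal_ne_top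
    (hmain 0 V.zero_mem)
  have hc84 : 0 < 84 * c := by linarith
  rw [← ENNReal.ofReal_toReal hfin]
  refine ENNReal.ofReal_le_ofReal ?_
  rw [← div_le_iff₀' hc84]
  refine le_ciInf fun g => ?_
  rw [div_le_iff₀' hc84]
  exact ENNReal.toReal_le_of_le_ofReal
    (mul_nonneg hc84.le (Real.iSup_nonneg fun x => norm_nonneg _)) (hmain g g.2)
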